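/- Let $S=\mathbb{Q}[x_1,\dots,x_6]$. For ideals $A\subseteq B$ of $S$ and $f\in S$, call $C=fB+A$ a *basic double G-link* if $A$ and $B$ are proper, homogeneous, saturated and height unmixed (all associated primes of the ideal have the same height), $S/A$ is Cohen–Macaulay and generically Gorenstein (its localization at every minimal prime is Gorenstein), $\operatorname{ht}(A)+1=\operatorname{ht}(B)$, $f$ is homogeneous of positive degree, and $A:f=A$. Let $\mathcal{T}$ be the set of the ten triples $156,\,246,\,146,\,236,\,126,\,345,\,145,\,235,\,135,\,234$ of elements of $\{1,\dots,6\}$, and let $$I=(x_2x_3x_4,\;x_1x_3x_5,\;x_2x_3x_5,\;x_1x_4x_5,\;x_3x_4x_5,\;x_1x_2x_6,\;x_2x_3x_6,\;x_1x_4x_6,\;x_2x_4x_6,\;x_1x_5x_6)\subseteq S$$ be the ideal generated by the monomials $x_ax_bx_c$ with $abc\in\mathcal{T}$. Let $\Delta$ be the simplicial complex on $\{1,\dots,6\}$ whose facets are the triples in $\mathcal{T}$, and let $I_\Delta=(\prod_{i\in F}x_i : F\subseteq\{1,\dots,6\},\ F\notin\Delta)\subseteq S$ be its Stanley–Reisner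 ideal. Then there is no basic double G-link $I=fB+A$ in which $A$ and $B$ are squarefree monomial ideals and $f$ is a sum of monic monomials. Likewise there is no basic double G-link $I_\Delta=fB+A$ in which $A$ and $B$ are squarefree monomial ideals and $f$ is a sum of monic monomials. -/

import Mathlib

/-- A Noetherian local ring is Cohen-Macaulay when its depth equals its Krull dimension, i.e. when
its maximal ideal contains a regular sequence of length the Krull dimension. -/
def IsCohenMacaulayLocal (R : Type*) [CommRing R] [IsLocalRing R] : Prop :=
  ∃ rs : List R, (∀ r ∈ rs, r ∈ IsLocalRing.maximalIdeal R) ∧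
    RingTheory.Sequence.IsRegular R rs ∧ (rs.length : WithBot ℕ∞) = ringKrullDim R

/-- A Noetherian ring is Cohen-Macaulay when all its localizations at primes are. -/
def IsCohenMacaulayRing (R : Type*) [CommRing R] : Prop :=
  IsNoetherianRing R ∧
    ∀ (P : Ideal R) [P.IsPrime], IsCohenMacaulayLocal (Localization.AtPrime P)

/-- A Noetherian local ring is Gorenstein when it has finite injective dimension as a module over
itself. -/
def IsGorensteinLocal (R : Type*) [CommRing R] [IsLocalRing R] : Prop :=
  IsNoetherianRing R ∧
    ∃ n : ℕ, CategoryTheory.HasInjectiveDimensionLE (ModuleCat.of R R) n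

/-- A ring is generically Gorenstein when its localization at every minimal prime is Gorenstein.
For a quotient `S ⧸ A`, the minimal primes of the ring correspond to the minimal primes of `A`. -/
def IsGenericallyGorenstein (R : Type*) [CommRing R] : Prop :=
  ∀ (P : Ideal R) [P.IsPrime], P ∈ minimalPrimes R →
    IsGorensteinLocal (Localization.AtPrime P)

/-- An ideal is (height) unmixed when all its associated primes have the same height. -/
def IsHeightUnmixed {R : Type*} [CommRing R] (I : Ideal R) : Prop :=
  ∀ P ∈ associatedPrimes R (R ⧸ I), ∀ Q ∈ associatedPrimes R (R ⧸ I), P.height = Q.height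

section Polynomial

variable {k : Type*} [Field k] {n : ℕ}

/-- A homogeneous ideal of `k[x_1, …, x_n]` for the standard grading: it contains the homogeneous
components of its elements. -/
def IsHomogeneousIdeal (I : Ideal (MvPolynomial (Fin n) k)) : Prop :=
  ∀ g ∈ I, ∀ d : ℕ, MvPolynomial.homogeneousComponent d g ∈ I

/-- An ideal `I` is saturated (with respect to `(x_1, …, x_n)`) when
`I : (x_1, …, x_n) = I`. -/
def IsSaturatedIdeal (I : Ideal (MvPolynomial (Fin n) k)) : Prop :=
  I.colon (Ideal.span (Set.range (MvPolynomial.X : Fin n → MvPolynomial (Fin n) k))) = I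

/-- `C = f B + A` is a basic double G-link (of `B` on `A`, of degree `deg f`). All ideals are proper,
homogeneous and saturated. -/
structure IsBasicDoubleGLink (C : Ideal (MvPolynomial (Fin n) k)) (f : MvPolynomial (Fin n) k)
    (B A : Ideal (MvPolynomial (Fin n) k)) : Prop where
  properA : A ≠ ⊤
  properB : B ≠ ⊤
  homogeneousA : IsHomogeneousIdeal A
  homogeneousB : IsHomogeneousIdeal B
  saturatedA : IsSaturatedIdeal A
  saturatedB : IsSaturatedIdeal B
  le : A ≤ B
  unmixedA : IsHeightUnmixed A
  unmixedB : IsHeightUnmixed B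
  cohenMacaulay : IsCohenMacaulayRing (MvPolynomial (Fin n) k ⧸ A)
  genericallyGorenstein : IsGenericallyGorenstein (MvPolynomial (Fin n) k ⧸ A)
  height_eq : A.height + 1 = B.height
  homogeneous : ∃ d : ℕ, 0 < d ∧ f.IsHomogeneous d
  colon_eq : A.colon (Ideal.span {f}) = A
  eq : C = Ideal.span {f} * B + A

/-- The squarefree monomial `x_F`, the product of the variables indexed by `F`. -/
noncomputable def squarefreeMonomial (k : Type*) [Field k] {n : ℕ} (F : Finset (Fin n)) :
    MvPolynomial (Fin n) k :=
  ∏ i ∈ F, MvPolynomial.X i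

/-- An ideal generated by a set of squarefree monomials. -/
def IsSquarefreeMonomialIdeal (I : Ideal (MvPolynomial (Fin n) k)) : Prop :=
  ∃ s : Set (Finset (Fin n)), I = Ideal.span (squarefreeMonomial k '' s)

/-- `f` is a finite sum of monic monomials. -/
def IsSumOfMonicMonomials (f : MvPolynomial (Fin n) k) : Prop :=
  f ∈ AddSubmonoid.closure (Set.range fun m : Fin n →₀ ℕ => MvPolynomial.monomial m (1 : k))

/-- The Stanley-Reisner ideal of a simplicial complex on the vertex set `Fin n` (a family of
subsets closed under passing to subsets): it is generated by the `x_F` with `F` a nonface. -/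
noncomputable def stanleyReisnerIdeal (k : Type*) [Field k] {n : ℕ} (Δ : LowerSet (Finset (Fin n))) :
    Ideal (MvPolynomial (Fin n) k) :=
  Ideal.span (squarefreeMonomial k '' {F | F ∉ Δ})

end Polynomial

/-- The ten triples `156, 246, 146, 236, 126, 345, 145, 235, 135, 234` of elements of `{1, …, 6}`.
The element `i` is `i - 1` of `Fin 6`, here and everywhere below. -/
def exampleTriples : Finset (Finset (Fin 6)) :=
  {{0, 4, 5}, {1, 3, 5}, {0, 3, 5}, {1, 2, 5}, {0, 1, 5},
    {2, 3, 4}, {0, 3, 4}, {1, 2, 4}, {0, 2, 4}, {1, 2, 3}}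

/-- The simplicial complex on `{1, …, 6}` whose facets are the ten triples. -/
def exampleComplex : LowerSet (Finset (Fin 6)) :=
  lowerClosure (exampleTriples : Set (Finset (Fin 6)))

/-- The ideal of `ℚ[x_1, …, x_6]` generated by the ten monomials `x_a x_b x_c`, for `abc` one of the
ten triples. -/
noncomputable def exampleIdeal : Ideal (MvPolynomial (Fin 6) ℚ) :=
  Ideal.span (squarefreeMonomial ℚ '' (exampleTriples : Set (Finset (Fin 6))))

/-! A squarefree basic double G-link `C = fB + A` forces `A` to be generated by the generators of
`C` that avoid one variable `x_i`. That leaves six candidates for `A` in each case, all of which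
fail a hypothesis on `A`.

To find `x_i`: since `A : f = A`, `f` lies in no minimal prime `P_F` of `A`. For a monomial of `B`
outside `P_F`, the product with `f` has a monomial that survives modulo `P_F`; it lies in `C`, hence
is a multiple of `f` modulo `P_F`. So `f` is a single term modulo `P_F` (`exists_sub_monomial_mem`).
Cohen-Macaulayness connects the minimal primes in codimension one (`exists_adjacent_minimalCovers`),
and comparing adjacent primes shows that the same monomial `m` serves everywhere
(`exists_monomial`). As `f` has positive degree, some `x_i` divides `m`, and no minimal prime of `A`
contains it; `exists_eq_span` follows.

For five of the six indices the deletion has minimal primes of different heights. For the index `3`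
of `Fin 6` it is the ideal of a five-vertex Möbius strip coned over the vertex `3`. Its nonzero
rational `H¹` obstructs depth three, by an explicit cocycle
(`exists_coboundary_of_isCohenMacaulayRing`). -/

open MvPolynomial

/-! ### Koszul cohomology and depth -/

section Koszul

open RingTheory.Sequence Pointwise

variable {R : Type*} [CommRing R] {ι : Type*} [Fintype ι] (u : ι → R)

theorem eq_zero_of_forall_smul_eq_zero {M : Type*} [AddCommGroup M] [Module R M] {x : R}
    (hx : x ∈ Ideal.span (Set.range u)) (hreg : IsSMulRegular M x) {m : M}
    (hm : ∀ i, u i • m = 0) : m = 0 := by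
  obtain ⟨c, rfl⟩ := (Ideal.mem_span_range_iff_exists_fun).1 hx
  refine hreg ?_
  simp [Finset.sum_smul, mul_smul, hm]

theorem quotSMulTop_mk_eq_zero_iff {M : Type*} [AddCommGroup M] [Module R M] (x : R) (m : M) :
    (Submodule.Quotient.mk m : QuotSMulTop x M) = 0 ↔ ∃ w : M, m = x • w := by
  rw [Submodule.Quotient.mk_eq_zero, Submodule.mem_smul_pointwise_iff_exists]
  simp [eq_comm]

/-- Vanishing of the first Koszul cohomology of a module of depth at least two. -/
theorem exists_eq_smul_of_koszul_cocycle {M : Type*} [AddCommGroup M] [Module R M]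
    {x y : R} {rs : List R} (hx : x ∈ Ideal.span (Set.range u)) (hy : y ∈ Ideal.span (Set.range u))
    (hreg : IsWeaklyRegular M (x :: y :: rs)) (s : ι → M)
    (hs : ∀ i j, u i • s j = u j • s i) : ∃ c : M, ∀ j, s j = u j • c := by
  rw [isWeaklyRegular_cons_iff, isWeaklyRegular_cons_iff] at hreg
  obtain ⟨hregx, hregy, -⟩ := hreg
  obtain ⟨c, rfl⟩ := (Ideal.mem_span_range_iff_exists_fun).1 hx
  have key : ∀ j, (∑ i, c i * u i) • s j = u j • ∑ i, c i • s i := fun j => by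
    simp only [Finset.sum_smul, Finset.smul_sum, mul_smul, hs _ j]
    exact Finset.sum_congr rfl fun i _ => smul_comm _ _ _
  -- Modulo `x` every `u j` kills this sum, while `y`, a combination of the `u j`, stays regular
  -- there.
  have h0 : (Submodule.Quotient.mk (∑ i, c i • s i) : QuotSMulTop (∑ i, c i * u i) M) = 0 := by
    refine eq_zero_of_forall_smul_eq_zero u hy hregy fun j => ?_
    rw [← Submodule.Quotient.mk_smul, ← key, quotSMulTop_mk_eq_zero_iff]
    exact ⟨_, rfl⟩
  obtain ⟨w, hw⟩ := (quotSMulTop_mk_eq_zero_iff _ _).1 h0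
  refine ⟨w, fun j => hregx ?_⟩
  change (∑ i, c i * u i) • s j = (∑ i, c i * u i) • u j • w
  rw [key, hw, smul_comm]

/-- Vanishing of the second Koszul cohomology of a module of depth at least three. -/
theorem exists_eq_sub_of_koszul_cocycle {M : Type*} [AddCommGroup M] [Module R M]
    {x y z : R} {rs : List R} (hx : x ∈ Ideal.span (Set.range u))
    (hy : y ∈ Ideal.span (Set.range u)) (hz : z ∈ Ideal.span (Set.range u))
    (hreg : IsWeaklyRegular M (x :: y :: z :: rs)) (r : ι → ι → M)
    (hr : ∀ i j k, u i • r j k = u j • r i k - u k • r i j) :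
    ∃ s : ι → M, ∀ j k, r j k = u j • s k - u k • s j := by
  rw [isWeaklyRegular_cons_iff] at hreg
  obtain ⟨hregx, hregy⟩ := hreg
  obtain ⟨c, hc⟩ := (Ideal.mem_span_range_iff_exists_fun).1 hx
  have key : ∀ j k, x • r j k = u j • (∑ i, c i • r i k) - u k • ∑ i, c i • r i j := fun j k => by
    rw [← hc]
    simp only [Finset.sum_smul, Finset.smul_sum, mul_smul, hr _ j k, ← Finset.sum_sub_distrib,
      smul_sub]
    exact Finset.sum_congr rfl fun i _ => by rw [smul_comm, smul_comm (c i) (u k)]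
  -- By `key`, contracting `r` with the coefficients of `x` gives a 1-cocycle modulo `x`, where `y,
  -- z` remain regular. Its defect from a coboundary upstairs is `x • s j`.
  obtain ⟨w, hw⟩ := exists_eq_smul_of_koszul_cocycle u hy hz hregy
    (fun j => (Submodule.Quotient.mk (∑ i, c i • r i j) : QuotSMulTop x M)) fun j k => by
      rw [← Submodule.Quotient.mk_smul, ← Submodule.Quotient.mk_smul, ← sub_eq_zero,
        ← Submodule.Quotient.mk_sub, ← key, quotSMulTop_mk_eq_zero_iff]
      exact ⟨_, rfl⟩
  obtain ⟨w, rfl⟩ := Submodule.Quotient.mk_surjective _ w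
  have hs : ∀ j, ∃ s, ∑ i, c i • r i j - u j • w = x • s := fun j => by
    rw [← quotSMulTop_mk_eq_zero_iff, Submodule.Quotient.mk_sub, sub_eq_zero, hw,
      Submodule.Quotient.mk_smul]
  choose s hs using hs
  refine ⟨s, fun j k => hregx ?_⟩
  change x • r j k = x • (u j • s k - u k • s j)
  rw [key, smul_sub, smul_comm x, smul_comm x (u k), ← hs, ← hs, smul_sub, smul_sub,
    smul_comm (u j) (u k)]
  abel

end Koszul

/-! ### Squarefree monomial ideals and their minimal primes -/

section Monomial

variable {k : Type*} [Field k] {n : ℕ}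

/-- The prime ideal generated by the variables indexed by `F`. -/
noncomputable def variableIdeal (k : Type*) [Field k] {n : ℕ} (F : Finset (Fin n)) :
    Ideal (MvPolynomial (Fin n) k) :=
  Ideal.span (X '' (F : Set (Fin n)))

theorem mem_variableIdeal {F : Finset (Fin n)} {p : MvPolynomial (Fin n) k} :
    p ∈ variableIdeal k F ↔ ∀ u, coeff u p ≠ 0 → ∃ i ∈ F, u i ≠ 0 := by
  simp [variableIdeal, mem_ideal_span_X_image]

theorem X_mem_variableIdeal {F : Finset (Fin n)} {i : Fin n} (hi : i ∈ F) :
    (X i : MvPolynomial (Fin n) k) ∈ variableIdeal k F :=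
  Ideal.subset_span ⟨i, hi, rfl⟩

theorem variableIdeal_mono {F G : Finset (Fin n)} (h : F ⊆ G) :
    variableIdeal k F ≤ variableIdeal k G :=
  Ideal.span_mono (Set.image_mono (by exact_mod_cast h))

/-- Setting the variables indexed by `F` to zero. -/
noncomputable def killVars (k : Type*) [Field k] {n : ℕ} (F : Finset (Fin n)) :
    MvPolynomial (Fin n) k →ₐ[k] MvPolynomial (Fin n) k :=
  aeval fun i => if i ∈ F then 0 else X i

theorem sub_killVars_mem (F : Finset (Fin n)) (p : MvPolynomial (Fin n) k) :
    p - killVars k F p ∈ variableIdeal k F := by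
  induction p using MvPolynomial.induction_on with
  | C a => simp [killVars]
  | add p q hp hq =>
    rw [map_add, add_sub_add_comm]
    exact add_mem hp hq
  | mul_X p i hp =>
    by_cases hi : i ∈ F
    · simpa [killVars, hi] using Ideal.mul_mem_left _ p (X_mem_variableIdeal hi)
    · rw [map_mul, show killVars k F (X i) = X i by simp [killVars, hi], ← sub_mul]
      exact Ideal.mul_mem_right _ _ hp

theorem ker_killVars (F : Finset (Fin n)) :
    RingHom.ker (killVars k F) = variableIdeal k F := by
  refine le_antisymm (fun p hp => ?_) (Ideal.span_le.2 ?_)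
  · simpa [(RingHom.mem_ker).1 hp] using sub_killVars_mem F p
  · rintro _ ⟨i, hi, rfl⟩
    simp [killVars, Finset.mem_coe.1 hi]

theorem killVars_eq_zero_iff {F : Finset (Fin n)} {p : MvPolynomial (Fin n) k} :
    killVars k F p = 0 ↔ p ∈ variableIdeal k F := by
  rw [← ker_killVars, RingHom.mem_ker]

theorem killVars_monomial {F : Finset (Fin n)} {u : Fin n →₀ ℕ} (hu : ∀ i ∈ F, u i = 0) (c : k) :
    killVars k F (monomial u c) = monomial u c := by
  rw [killVars, aeval_monomial, monomial_eq]
  congr 1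
  refine Finsupp.prod_congr fun i hi => ?_
  rw [if_neg fun h => (Finsupp.mem_support_iff.1 hi) (hu i h)]

instance isPrime_variableIdeal (F : Finset (Fin n)) : (variableIdeal k F).IsPrime := by
  rw [← ker_killVars]
  exact RingHom.ker_isPrime _

theorem monomial_mem_variableIdeal {F : Finset (Fin n)} {u : Fin n →₀ ℕ} {c : k} (hc : c ≠ 0) :
    monomial u c ∈ variableIdeal k F ↔ ∃ i ∈ F, u i ≠ 0 := by
  classical
  rw [mem_variableIdeal]
  constructor
  · exact fun h => h u (by simpa)
  · intro h v hv
    rw [coeff_monomial] at hv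
    split_ifs at hv with huv
    · exact huv ▸ h
    · exact absurd rfl hv

theorem variableIdeal_lt_insert {F : Finset (Fin n)} {i : Fin n} (hi : i ∉ F) :
    variableIdeal k F < variableIdeal k (insert i F) := by
  refine lt_of_le_of_ne (variableIdeal_mono (Finset.subset_insert _ _)) fun h => ?_
  have hX : (X i : MvPolynomial (Fin n) k) ∈ variableIdeal k F :=
    h ▸ X_mem_variableIdeal (Finset.mem_insert_self _ _)
  obtain ⟨j, hj, hji⟩ := (monomial_mem_variableIdeal one_ne_zero).1 hX
  rw [Finsupp.single_apply_ne_zero] at hji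
  exact hi (hji.1 ▸ hj)

/-- The exponent of a squarefree monomial. -/
noncomputable def finsetExponent {n : ℕ} (T : Finset (Fin n)) : Fin n →₀ ℕ :=
  ∑ i ∈ T, Finsupp.single i 1

theorem finsetExponent_apply (T : Finset (Fin n)) (i : Fin n) :
    finsetExponent T i = if i ∈ T then 1 else 0 := by
  classical
  simp [finsetExponent, Finsupp.finsetSum_apply, Finsupp.single_apply]

theorem squarefreeMonomial_eq (T : Finset (Fin n)) :
    squarefreeMonomial k T = monomial (finsetExponent T) 1 := by
  rw [squarefreeMonomial, finsetExponent, monomial_sum_one]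
  rfl

theorem finsetExponent_le_iff {T : Finset (Fin n)} {u : Fin n →₀ ℕ} :
    finsetExponent T ≤ u ↔ ∀ i ∈ T, u i ≠ 0 := by
  constructor
  · intro h i hi
    have := h i
    rw [finsetExponent_apply, if_pos hi] at this
    omega
  · intro h i
    rw [finsetExponent_apply]
    split_ifs with hi
    · exact Nat.one_le_iff_ne_zero.2 (h i hi)
    · exact Nat.zero_le _

theorem squarefreeMonomial_mem_variableIdeal {T F : Finset (Fin n)} :
    squarefreeMonomial k T ∈ variableIdeal k F ↔ ∃ i ∈ T, i ∈ F := by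
  rw [squarefreeMonomial_eq, monomial_mem_variableIdeal one_ne_zero]
  simp [finsetExponent_apply, and_comm]

theorem mem_span_squarefreeMonomial {s : Set (Finset (Fin n))} {p : MvPolynomial (Fin n) k} :
    p ∈ Ideal.span (squarefreeMonomial k '' s) ↔
      ∀ u, coeff u p ≠ 0 → ∃ T ∈ s, ∀ i ∈ T, u i ≠ 0 := by
  have h : squarefreeMonomial k '' s =
      (fun u => monomial u (1 : k)) '' (finsetExponent '' s) := by
    rw [Set.image_image]
    exact Set.image_congr fun T _ => squarefreeMonomial_eq T
  rw [h, mem_ideal_span_monomial_image]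
  simp [finsetExponent_le_iff]

theorem span_le_variableIdeal_iff {s : Set (Finset (Fin n))} {F : Finset (Fin n)} :
    Ideal.span (squarefreeMonomial k '' s) ≤ variableIdeal k F ↔ ∀ T ∈ s, ∃ i ∈ T, i ∈ F := by
  rw [Ideal.span_le, Set.image_subset_iff]
  exact forall₂_congr fun T _ => squarefreeMonomial_mem_variableIdeal

/-- `F` is a minimal set of variables generating an ideal that contains `I`. -/
def IsMinimalCover (I : Ideal (MvPolynomial (Fin n) k)) (F : Finset (Fin n)) : Prop :=
  Minimal (fun G => I ≤ variableIdeal k G) F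

theorem exists_minimalCover_subset {I : Ideal (MvPolynomial (Fin n) k)} {F : Finset (Fin n)}
    (h : I ≤ variableIdeal k F) : ∃ G ⊆ F, IsMinimalCover I G :=
  exists_minimal_le_of_wellFoundedLT (fun G => I ≤ variableIdeal k G) F h

namespace IsSquarefreeMonomialIdeal

variable {I : Ideal (MvPolynomial (Fin n) k)}

/-- If no generator divides `x^u`, the variables absent from `x^u` meet every generator. A minimal
cover among them has a prime not containing `x^u`. -/
theorem mem_of_forall_variableIdeal (hI : IsSquarefreeMonomialIdeal I)
    {p : MvPolynomial (Fin n) k}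
    (h : ∀ F, IsMinimalCover I F → p ∈ variableIdeal k F) : p ∈ I := by
  obtain ⟨s, rfl⟩ := hI
  rw [mem_span_squarefreeMonomial]
  intro u hu
  by_contra! hT
  obtain ⟨G, hGF, hG⟩ := exists_minimalCover_subset
    (F := Finset.univ.filter fun i => u i = 0) (span_le_variableIdeal_iff (k := k).2 fun T hT' => by
      simpa using hT T hT')
  obtain ⟨i, hi, hui⟩ := mem_variableIdeal.1 (h G hG) u hu
  exact hui (by simpa using hGF hi)

theorem monomial_mem (hI : IsSquarefreeMonomialIdeal I) {p : MvPolynomial (Fin n) k} (hp : p ∈ I)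
    {u : Fin n →₀ ℕ} (hu : coeff u p ≠ 0) : monomial u 1 ∈ I := by
  classical
  obtain ⟨s, rfl⟩ := hI
  rw [mem_span_squarefreeMonomial] at hp ⊢
  intro v hv
  rw [coeff_monomial] at hv
  split_ifs at hv with huv
  · exact huv ▸ hp u hu
  · exact absurd rfl hv

theorem monomial_mem_of_support_subset (hI : IsSquarefreeMonomialIdeal I) {u v : Fin n →₀ ℕ}
    (hu : monomial u (1 : k) ∈ I) (huv : ∀ i, u i ≠ 0 → v i ≠ 0) : monomial v (1 : k) ∈ I :=
  hI.mem_of_forall_variableIdeal fun F hF => by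
    rw [monomial_mem_variableIdeal one_ne_zero]
    obtain ⟨i, hi, hui⟩ := (monomial_mem_variableIdeal one_ne_zero).1 (hF.prop hu)
    exact ⟨i, hi, huv i hui⟩

theorem exists_squarefreeMonomial_notMem (hI : IsSquarefreeMonomialIdeal I)
    {F : Finset (Fin n)} (h : ¬ I ≤ variableIdeal k F) :
    ∃ T, squarefreeMonomial k T ∈ I ∧ squarefreeMonomial k T ∉ variableIdeal k F := by
  obtain ⟨s, rfl⟩ := hI
  rw [Ideal.span_le, Set.not_subset] at h
  obtain ⟨_, ⟨T, hT, rfl⟩, hTF⟩ := h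
  exact ⟨T, Ideal.subset_span ⟨T, hT, rfl⟩, hTF⟩

theorem le_of_forall_squarefreeMonomial (hI : IsSquarefreeMonomialIdeal I)
    {J : Ideal (MvPolynomial (Fin n) k)}
    (h : ∀ T, squarefreeMonomial k T ∈ I → squarefreeMonomial k T ∈ J) : I ≤ J := by
  obtain ⟨s, rfl⟩ := hI
  rw [Ideal.span_le]
  rintro _ ⟨T, hT, rfl⟩
  exact h T (Ideal.subset_span ⟨T, hT, rfl⟩)

theorem exists_minimalCover (hI : IsSquarefreeMonomialIdeal I) (htop : I ≠ ⊤) :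
    ∃ F, IsMinimalCover I F := by
  by_contra! h
  exact htop ((Ideal.eq_top_iff_one _).2 (hI.mem_of_forall_variableIdeal fun F hF => (h F hF).elim))

/-- A prime over `I` contains a variable of each generator, so the variables it contains already
generate a prime over `I`. -/
theorem exists_eq_variableIdeal {P : Ideal (MvPolynomial (Fin n) k)}
    (hI : IsSquarefreeMonomialIdeal I) (hP : P ∈ I.minimalPrimes) :
    ∃ F, P = variableIdeal k F := by
  classical
  have := hP.1.1
  let F : Finset (Fin n) := Finset.univ.filter fun i => X i ∈ P
  have hF : variableIdeal k F ≤ P := by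
    rw [variableIdeal, Ideal.span_le]
    rintro _ ⟨i, hi, rfl⟩
    simpa [F] using hi
  refine ⟨F, le_antisymm (hP.2 ⟨inferInstance, ?_⟩ hF) hF⟩
  refine hI.le_of_forall_squarefreeMonomial fun T hT => ?_
  obtain ⟨i, hi, hiP⟩ := (Ideal.IsPrime.prod_mem_iff).1 (hP.1.2 hT)
  exact squarefreeMonomial_mem_variableIdeal.2 ⟨i, hi, by simpa [F] using hiP⟩

end IsSquarefreeMonomialIdeal

theorem variableIdeal_le_iff {F G : Finset (Fin n)} :
    variableIdeal k F ≤ variableIdeal k G ↔ F ⊆ G := by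
  refine ⟨fun h i hi => ?_, variableIdeal_mono⟩
  obtain ⟨j, hj, hji⟩ := (monomial_mem_variableIdeal one_ne_zero).1 (h (X_mem_variableIdeal hi))
  rw [Finsupp.single_apply_ne_zero] at hji
  exact hji.1 ▸ hj

theorem IsMinimalCover.mem_minimalPrimes {I : Ideal (MvPolynomial (Fin n) k)}
    (hI : IsSquarefreeMonomialIdeal I) {F : Finset (Fin n)} (hF : IsMinimalCover I F) :
    variableIdeal k F ∈ I.minimalPrimes := by
  obtain ⟨P, hP, hPF⟩ := Ideal.exists_minimalPrimes_le hF.prop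
  obtain ⟨G, rfl⟩ := hI.exists_eq_variableIdeal hP
  have hGF := variableIdeal_le_iff.1 hPF
  rwa [hGF.antisymm (hF.le_of_le hP.1.2 hGF)] at hP

theorem mem_associatedPrimes_of_mem_minimalPrimes {R : Type*} [CommRing R] [IsNoetherianRing R]
    {I P : Ideal R} (hP : P ∈ I.minimalPrimes) : P ∈ associatedPrimes R (R ⧸ I) := by
  refine Module.associatedPrimes.minimalPrimes_annihilator_subset_associatedPrimes R (R ⧸ I) ?_
  rwa [Ideal.annihilator_quotient]

end Monomial

/-! ### Heights and unmixedness -/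

section Height

variable {k : Type*} [Field k] {n : ℕ}

/-- Adjoining the elements of `W` to `F` one at a time gives a chain of primes; it stays strict in
`R` because every prime in it contains the kernel. -/
theorem card_le_height_map {R : Type*} [CommRing R] (f : MvPolynomial (Fin n) k →+* R)
    (hf : Function.Surjective f) {F W : Finset (Fin n)}
    (hker : RingHom.ker f ≤ variableIdeal k F) (hFW : Disjoint F W) :
    (W.card : ℕ∞) ≤ ((variableIdeal k (F ∪ W)).map f).height := by
  induction W using Finset.induction_on with
  | empty => simp
  | insert i W hi ih =>
    rw [Finset.disjoint_insert_right] at hFW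
    have hle : ∀ {G : Finset (Fin n)}, F ⊆ G → RingHom.ker f ≤ variableIdeal k G := fun h =>
      hker.trans (variableIdeal_mono h)
    have h1 := Ideal.map_isPrime_of_surjective hf (hle (Finset.subset_union_left (s₂ := W)))
    have h2 := Ideal.map_isPrime_of_surjective hf (hle (Finset.subset_union_left (s₂ := insert i W)))
    have hlt := variableIdeal_lt_insert (k := k) (F := F ∪ W) (i := i) (by simp [hi, hFW.1])
    rw [← Finset.union_insert] at hlt
    have hlt' : (variableIdeal k (F ∪ W)).map f < (variableIdeal k (F ∪ insert i W)).map f := by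
      refine lt_of_le_of_ne (Ideal.map_mono hlt.le) fun h => hlt.not_ge ?_
      have := congrArg (Ideal.comap f) h
      rw [Ideal.comap_map_of_surjective' f hf, Ideal.comap_map_of_surjective' f hf,
        sup_eq_left.2 (hle Finset.subset_union_left),
        sup_eq_left.2 (hle Finset.subset_union_left)] at this
      exact this.ge
    rw [Finset.card_insert_of_notMem hi, Nat.cast_add, Nat.cast_one]
    exact (add_le_add_left (ih hFW.2) 1).trans (Ideal.height_add_one_le_of_lt_of_isPrime hlt')

theorem height_variableIdeal (F : Finset (Fin n)) : (variableIdeal k F).height = F.card := by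
  classical
  refine le_antisymm ?_ ?_
  · have hmin : variableIdeal k F ∈ (Ideal.span
        ((F.image X : Finset (MvPolynomial (Fin n) k)) : Set _)).minimalPrimes := by
      rw [Finset.coe_image, ← variableIdeal, Ideal.minimalPrimes_eq_subsingleton_self]
      rfl
    exact (Ideal.height_le_card_of_mem_minimalPrimes_span_finset hmin).trans
      (by exact_mod_cast Finset.card_image_le)
  · have := card_le_height_map (RingHom.id (MvPolynomial (Fin n) k)) Function.surjective_id
      (F := ∅) (W := F) (((RingHom.injective_iff_ker_eq_bot _).1 Function.injective_id).le.trans bot_le)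
      (Finset.disjoint_empty_left _)
    simpa using this

theorem IsMinimalCover.height_eq {I : Ideal (MvPolynomial (Fin n) k)}
    (hI : IsSquarefreeMonomialIdeal I) (hunm : IsHeightUnmixed I) {F : Finset (Fin n)}
    (hF : IsMinimalCover I F) : I.height = F.card := by
  rw [Ideal.height_eq_inf_minimalPrimes, ← height_variableIdeal (k := k) F]
  have hFm := hF.mem_minimalPrimes hI
  refine le_antisymm (iInf₂_le _ hFm) (le_iInf₂ fun P hP => ?_)
  exact (hunm _ (mem_associatedPrimes_of_mem_minimalPrimes hFm) _
    (mem_associatedPrimes_of_mem_minimalPrimes hP)).le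

theorem IsMinimalCover.card_eq {I : Ideal (MvPolynomial (Fin n) k)}
    (hI : IsSquarefreeMonomialIdeal I) (hunm : IsHeightUnmixed I) {F G : Finset (Fin n)}
    (hF : IsMinimalCover I F) (hG : IsMinimalCover I G) : F.card = G.card := by
  have := (hF.height_eq hI hunm).symm.trans (hG.height_eq hI hunm)
  exact_mod_cast this

end Height

/-! ### Consequences of Cohen-Macaulayness -/

section CohenMacaulay

open RingTheory.Sequence

universe v

variable {k : Type v} [Field k] {n : ℕ} {A : Ideal (MvPolynomial (Fin n) k)}

/-- The structure of the localization of `S ⧸ A` at the image of a prime generated by variables. -/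
theorem exists_localization_of_isCohenMacaulayRing
    (hCM : IsCohenMacaulayRing (MvPolynomial (Fin n) k ⧸ A)) {F V : Finset (Fin n)}
    (hF : A ≤ variableIdeal k F) (hFV : F ⊆ V) :
    ∃ (L : Type v) (_ : CommRing L) (g : MvPolynomial (Fin n) k →+* L) (rs : List L),
      (∀ p ∈ A, g p = 0) ∧
      (∀ p, g p = 0 → ∀ G ⊆ V, A ≤ variableIdeal k G → p ∈ variableIdeal k G) ∧
      (∀ (ι : Type) [Finite ι] (a : ι → L), ∃ t, t ∉ variableIdeal k V ∧
        ∃ b : ι → MvPolynomial (Fin n) k, ∀ i, g t * a i = g (b i)) ∧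
      IsWeaklyRegular L rs ∧ V.card ≤ rs.length + F.card ∧
      ∀ r ∈ rs, r ∈ Ideal.span (Set.range fun i : V => g (X i)) := by
  have hsurj := Ideal.Quotient.mk_surjective (I := A)
  have hAV : A ≤ variableIdeal k V := hF.trans (variableIdeal_mono hFV)
  let Q := (variableIdeal k V).map (Ideal.Quotient.mk A)
  have hQ : Q.IsPrime := Ideal.map_isPrime_of_surjective hsurj (by rwa [Ideal.mk_ker])
  have hmemQ : ∀ p, Ideal.Quotient.mk A p ∈ Q ↔ p ∈ variableIdeal k V := fun p =>
    Ideal.mem_quotient_iff_mem hAV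
  obtain ⟨rs, hrs, hreg, hlen⟩ := hCM.2 Q
  -- Depth equals dimension, and the dimension is at least the length of a chain of primes from
  -- `P_F` to `P_V`.
  have hdim : ((V \ F).card : WithBot ℕ∞) ≤ rs.length := by
    rw [hlen, IsLocalization.AtPrime.ringKrullDim_eq_height Q]
    have := card_le_height_map (Ideal.Quotient.mk A) hsurj (F := F) (W := V \ F)
      (by rwa [Ideal.mk_ker]) Finset.disjoint_sdiff
    rw [Finset.union_sdiff_of_subset hFV] at this
    exact_mod_cast this
  refine ⟨Localization.AtPrime Q, inferInstance,
    (algebraMap _ (Localization.AtPrime Q)).comp (Ideal.Quotient.mk A), rs, ?_, ?_, ?_,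
    hreg.toIsWeaklyRegular, ?_, ?_⟩
  · intro p hp
    rw [RingHom.comp_apply, Ideal.Quotient.eq_zero_iff_mem.2 hp, map_zero]
  -- Denominators avoid `P_V`, hence also `P_G` for `G ⊆ V`.
  · intro p hp G hGV hAG
    rw [RingHom.comp_apply, IsLocalization.map_eq_zero_iff Q.primeCompl] at hp
    obtain ⟨⟨t, ht⟩, htp⟩ := hp
    obtain ⟨t, rfl⟩ := hsurj t
    rw [← map_mul, Ideal.Quotient.eq_zero_iff_mem] at htp
    refine ((isPrime_variableIdeal G).mem_or_mem (hAG htp)).resolve_left fun h => ht ?_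
    exact (hmemQ t).2 (variableIdeal_mono hGV h)
  · intro ι _ a
    obtain ⟨⟨t, ht⟩, hb⟩ := IsLocalization.exist_integer_multiples_of_finite Q.primeCompl a
    obtain ⟨t, rfl⟩ := hsurj t
    choose b hb using hb
    choose c hc using fun i => hsurj (b i)
    refine ⟨t, fun h => ht ((hmemQ t).2 h), c, fun i => ?_⟩
    rw [RingHom.comp_apply, RingHom.comp_apply, hc, hb, Algebra.smul_def]
  · have : (V \ F).card ≤ rs.length := by exact_mod_cast hdim
    rw [Finset.card_sdiff_of_subset hFV] at this
    omega
  · intro r hr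
    have := hrs r hr
    rw [← IsLocalization.AtPrime.map_eq_maximalIdeal Q, Ideal.map_map, variableIdeal,
      Ideal.map_span] at this
    convert! this using 2
    ext y
    simp

/-- A Koszul `1`-cocycle of a Cohen-Macaulay quotient is locally a coboundary. -/
theorem exists_mul_sub_mem_of_koszul_cocycle
    (hCM : IsCohenMacaulayRing (MvPolynomial (Fin n) k ⧸ A)) {F V : Finset (Fin n)}
    (hF : A ≤ variableIdeal k F) (hFV : F ⊆ V) (hcard : F.card + 2 ≤ V.card)
    (s : Fin n → MvPolynomial (Fin n) k)
    (hs : ∀ i ∈ V, ∀ j ∈ V, X i * s j - X j * s i ∈ A) :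
    ∃ t, t ∉ variableIdeal k V ∧ ∃ a, ∀ j ∈ V, ∀ G ⊆ V, A ≤ variableIdeal k G →
      t * s j - X j * a ∈ variableIdeal k G := by
  obtain ⟨L, _, g, rs, hg0, hg, hden, hreg, hlen, hrs⟩ :=
    exists_localization_of_isCohenMacaulayRing hCM hF hFV
  obtain _ | ⟨x, _ | ⟨y, rs⟩⟩ := rs
  · simp at hlen; omega
  · simp at hlen; omega
  obtain ⟨c, hc⟩ := exists_eq_smul_of_koszul_cocycle (fun i : V => g (X i))
    (hrs x (by simp)) (hrs y (by simp)) hreg (fun i => g (s i)) fun i j => by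
      have := hg0 _ (hs i i.2 j j.2)
      rw [map_sub, map_mul, map_mul, sub_eq_zero] at this
      simpa using this
  obtain ⟨t, ht, b, hb⟩ := hden Unit fun _ => c
  refine ⟨t, ht, b (), fun j hj G hGV hG => hg _ ?_ G hGV hG⟩
  rw [map_sub, map_mul, map_mul, ← hb, hc ⟨j, hj⟩, smul_eq_mul]
  ring

/-- A Koszul `2`-cocycle of a Cohen-Macaulay quotient is locally a coboundary. -/
theorem exists_mul_sub_sub_mem_of_koszul_cocycle
    (hCM : IsCohenMacaulayRing (MvPolynomial (Fin n) k ⧸ A)) {F V : Finset (Fin n)}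
    (hF : A ≤ variableIdeal k F) (hFV : F ⊆ V) (hcard : F.card + 3 ≤ V.card)
    (r : Fin n → Fin n → MvPolynomial (Fin n) k)
    (hr : ∀ i ∈ V, ∀ j ∈ V, ∀ l ∈ V, X i * r j l - X j * r i l + X l * r i j ∈ A) :
    ∃ t, t ∉ variableIdeal k V ∧ ∃ s : Fin n → MvPolynomial (Fin n) k,
      ∀ i ∈ V, ∀ j ∈ V, ∀ G ⊆ V, A ≤ variableIdeal k G →
        t * r i j - (X i * s j - X j * s i) ∈ variableIdeal k G := by
  classical
  obtain ⟨L, _, g, rs, hg0, hg, hden, hreg, hlen, hrs⟩ :=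
    exists_localization_of_isCohenMacaulayRing hCM hF hFV
  obtain _ | ⟨x, _ | ⟨y, _ | ⟨z, rs⟩⟩⟩ := rs
  · simp at hlen; omega
  · simp at hlen; omega
  · simp at hlen; omega
  obtain ⟨c, hc⟩ := exists_eq_sub_of_koszul_cocycle (fun i : V => g (X i))
    (hrs x (by simp)) (hrs y (by simp)) (hrs z (by simp)) hreg (fun i j => g (r i j))
    fun i j l => by
      have := hg0 _ (hr i i.2 j j.2 l l.2)
      simp only [map_sub, map_mul, map_add] at this
      simp only [smul_eq_mul]
      linear_combination this
  obtain ⟨t, ht, b, hb⟩ := hden (Fin n) fun i => if h : i ∈ V then c ⟨i, h⟩ else 0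
  refine ⟨t, ht, b, fun i hi j hj G hGV hG => hg _ ?_ G hGV hG⟩
  simp only [map_sub, map_mul, ← hb, hi, hj, dif_pos]
  rw [hc ⟨i, hi⟩ ⟨j, hj⟩]
  simp only [smul_eq_mul]
  ring

/-- Connectedness in codimension one of an equidimensional Cohen-Macaulay Stanley-Reisner ring. -/
theorem exists_adjacent_minimalCovers (hA : IsSquarefreeMonomialIdeal A)
    (hCM : IsCohenMacaulayRing (MvPolynomial (Fin n) k ⧸ A))
    (hcard : ∀ F G, IsMinimalCover A F → IsMinimalCover A G → F.card = G.card)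
    (c : Finset (Fin n) → Prop) (h₁ : ∃ F, IsMinimalCover A F ∧ c F)
    (h₂ : ∃ G, IsMinimalCover A G ∧ ¬ c G) :
    ∃ F G, IsMinimalCover A F ∧ IsMinimalCover A G ∧ c F ∧ ¬ c G ∧
      (F ∪ G).card ≤ F.card + 1 := by
  classical
  obtain ⟨F₁, hF₁, hcF₁⟩ := h₁
  obtain ⟨G₁, hG₁, hcG₁⟩ := h₂
  -- Take a pair on opposite sides with the smallest union `V`. If `V` is too large, the local ring
  -- at `P_V` has depth at least two, so its punctured spectrum should be connected; minimality of
  -- `V` disconnects it.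
  obtain ⟨⟨F, G⟩, hmem, hmin⟩ := Finset.exists_min_image
    (Finset.univ.filter fun q : Finset (Fin n) × Finset (Fin n) =>
      IsMinimalCover A q.1 ∧ IsMinimalCover A q.2 ∧ c q.1 ∧ ¬ c q.2)
    (fun q => (q.1 ∪ q.2).card) ⟨(F₁, G₁), by simp [*]⟩
  simp only [Finset.mem_filter, Finset.mem_univ, true_and, Prod.forall] at hmem hmin
  obtain ⟨hF, hG, hcF, hcG⟩ := hmem
  refine ⟨F, G, hF, hG, hcF, hcG, ?_⟩
  by_contra! hlt
  set V := F ∪ G with hV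
  have hVmin : ∀ F' ⊆ V, ∀ G' ⊆ V, IsMinimalCover A F' → IsMinimalCover A G' → c F' → ¬ c G' →
      F' ∪ G' = V := fun F' hF'V G' hG'V hF' hG' hcF' hcG' =>
    Finset.eq_of_subset_of_card_le (Finset.union_subset hF'V hG'V)
      (hmin F' G' ⟨hF', hG', hcF', hcG'⟩)
  -- The factor `w` vanishes modulo every cover not inside `V` but is outside `P_V`, so only covers
  -- inside `V` matter.
  let w : MvPolynomial (Fin n) k := squarefreeMonomial k Vᶜ
  have hw : ∀ {F'}, ¬ F' ⊆ V → w ∈ variableIdeal k F' := fun {F'} h => by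
    obtain ⟨i, hi, hiV⟩ := Finset.not_subset.1 h
    exact squarefreeMonomial_mem_variableIdeal.2 ⟨i, by simpa using hiV, hi⟩
  have hw' : ∀ {F'}, F' ⊆ V → w ∉ variableIdeal k F' := fun {F'} h hmem => by
    obtain ⟨i, hi, hiF⟩ := squarefreeMonomial_mem_variableIdeal.1 hmem
    exact (Finset.mem_compl.1 hi) (h hiF)
  have hX : ∀ {i : Fin n} {F' : Finset (Fin n)},
      (X i : MvPolynomial (Fin n) k) ∈ variableIdeal k F' ↔ i ∈ F' := fun {i F'} => by
    refine ⟨fun h => ?_, X_mem_variableIdeal⟩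
    obtain ⟨j, hj, hji⟩ := (monomial_mem_variableIdeal one_ne_zero).1 h
    exact (Finsupp.single_apply_ne_zero.1 hji).1 ▸ hj
  -- By minimality of `V`, each variable of `V` lies in all covers inside `V` satisfying `c`, or in
  -- all those not satisfying it.
  let J : Fin n → Prop := fun i => ∀ F' ⊆ V, IsMinimalCover A F' → c F' → i ∈ F'
  have hJ : ∀ i ∈ V, ¬ J i → ∀ G' ⊆ V, IsMinimalCover A G' → ¬ c G' → i ∈ G' := by
    intro i hi hJi G' hG'V hG' hcG'
    simp only [J] at hJi
    push Not at hJi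
    obtain ⟨F', hF'V, hF', hcF', hiF'⟩ := hJi
    have := hVmin F' hF'V G' hG'V hF' hG' hcF' hcG' ▸ hi
    exact (Finset.mem_union.1 this).resolve_left hiF'
  have hmix : ∀ i ∈ V, ∀ j ∈ V, J i → ¬ J j → X i * (X j * w) ∈ A := by
    intro i hi j hj hJi hJj
    refine hA.mem_of_forall_variableIdeal fun F' hF' => ?_
    by_cases hF'V : F' ⊆ V
    · by_cases hcF' : c F'
      · exact Ideal.mul_mem_right _ _ (hX.2 (hJi F' hF'V hF' hcF'))
      · exact Ideal.mul_mem_left _ _ (Ideal.mul_mem_right _ _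
          (hX.2 (hJ j hj hJj F' hF'V hF' hcF')))
    · exact Ideal.mul_mem_left _ _ (Ideal.mul_mem_left _ _ (hw hF'V))
  -- The cocycle encodes the function equal to `0` on the components satisfying `c` and to `w` on
  -- the others. A global such function, up to the factor `t`, is `a`.
  obtain ⟨t, ht, a, hta⟩ := exists_mul_sub_mem_of_koszul_cocycle hCM hF.prop
    (Finset.subset_union_left : F ⊆ V) hlt (fun i => if J i then X i * w else 0) (by
      intro i hi j hj
      by_cases hJi : J i <;> by_cases hJj : J j <;> simp only [hJi, hJj, if_true, if_false]
      · convert A.zero_mem using 1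
        ring
      · simpa [mul_left_comm] using hmix i hi j hj hJi hJj
      · simpa [mul_left_comm] using hmix j hj i hi hJj hJi
      · simp)
  have hFV : F ⊆ V := Finset.subset_union_left
  have hGV : G ⊆ V := Finset.subset_union_right
  have hFG := hcard F G hF hG
  obtain ⟨i, hiV, hiF⟩ := Finset.exists_of_ssubset (hFV.ssubset_of_ne fun h => by
    have := congrArg Finset.card h; omega)
  obtain ⟨j, hjV, hjG⟩ := Finset.exists_of_ssubset (hGV.ssubset_of_ne fun h => by
    have := congrArg Finset.card h; omega)
  have hJi : ¬ J i := fun h => hiF (h F hFV hF hcF)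
  have hJj : J j := by
    by_contra h
    exact hjG (hJ j hjV h G hGV hG hcG)
  have h1 := hta i hiV F hFV hF.prop
  have h2 := hta j hjV G hGV hG.prop
  simp only [hJi, hJj, if_true, if_false, mul_zero, zero_sub] at h1 h2
  rw [neg_mem_iff] at h1
  have ha : a ∈ variableIdeal k F := ((isPrime_variableIdeal F).mem_or_mem h1).resolve_left
    (fun h => hiF (hX.1 h))
  have h2' : X j * (t * w - a) ∈ variableIdeal k G := by
    convert h2 using 1
    ring
  have hta' := ((isPrime_variableIdeal G).mem_or_mem h2').resolve_left (fun h => hjG (hX.1 h))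
  -- Now `a` is `0` modulo `P_F` and `t * w` modulo `P_G`, and both primes lie in `P_V`.
  have htw : t * w ∈ variableIdeal k V := by
    have := add_mem (variableIdeal_mono hGV hta') (variableIdeal_mono hFV ha)
    rwa [sub_add_cancel] at this
  exact ((isPrime_variableIdeal V).mem_or_mem htw).elim ht (hw' le_rfl)

end CohenMacaulay

/-! ### The shape of `f` and `A` in a squarefree link -/

section BasicDoubleGLink

variable {k : Type*} [Field k] {n : ℕ} {A B C : Ideal (MvPolynomial (Fin n) k)}
  {f : MvPolynomial (Fin n) k}

namespace IsBasicDoubleGLink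

theorem not_le_variableIdeal (h : IsBasicDoubleGLink C f B A) (hA : IsSquarefreeMonomialIdeal A)
    {F : Finset (Fin n)} (hF : IsMinimalCover A F) : ¬ B ≤ variableIdeal k F := by
  intro hB
  have h1 := Ideal.height_mono hB
  rw [← h.height_eq, hF.height_eq hA h.unmixedA, height_variableIdeal] at h1
  have : F.card + 1 ≤ F.card := by exact_mod_cast h1
  omega

theorem mul_mem (h : IsBasicDoubleGLink C f B A) {b : MvPolynomial (Fin n) k} (hb : b ∈ B) :
    f * b ∈ C := by
  rw [h.eq]
  exact Ideal.mem_sup_left (Ideal.mul_mem_mul (Ideal.mem_span_singleton_self f) hb)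

theorem le_self (h : IsBasicDoubleGLink C f B A) : A ≤ C := by
  rw [h.eq]
  exact le_sup_right

theorem exists_sub_mem (h : IsBasicDoubleGLink C f B A) {p : MvPolynomial (Fin n) k}
    (hp : p ∈ C) : ∃ g ∈ B, p - f * g ∈ A := by
  rw [h.eq] at hp
  obtain ⟨q, hq, a, ha, rfl⟩ := Submodule.mem_sup.1 hp
  obtain ⟨g, hg, rfl⟩ := Ideal.mem_span_singleton_mul.1 hq
  exact ⟨g, hg, by simpa using ha⟩

/-- Modulo every minimal prime of `A`, the form `f` is a term. -/
theorem exists_sub_monomial_mem (h : IsBasicDoubleGLink C f B A)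
    (hA : IsSquarefreeMonomialIdeal A) (hB : IsSquarefreeMonomialIdeal B)
    (hC : IsSquarefreeMonomialIdeal C) (hf : ∀ F, IsMinimalCover A F → f ∉ variableIdeal k F)
    {F : Finset (Fin n)} (hF : IsMinimalCover A F) :
    ∃ m, (∀ i ∈ F, m i = 0) ∧ coeff m f ≠ 0 ∧ f - monomial m (coeff m f) ∈ variableIdeal k F := by
  classical
  obtain ⟨T, hTB, hTF⟩ := hB.exists_squarefreeMonomial_notMem (h.not_le_variableIdeal hA hF)
  have hfT : f * squarefreeMonomial k T ∉ variableIdeal k F := fun hmem =>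
    ((isPrime_variableIdeal F).mem_or_mem hmem).elim (hf F hF) hTF
  rw [mem_variableIdeal] at hfT
  push Not at hfT
  obtain ⟨u, hu, huF⟩ := hfT
  -- The surviving monomial `x^u` lies in `C`, so setting the variables of `F` to zero exhibits it
  -- as a multiple of the image of `f`; divisors of monomials are terms.
  obtain ⟨g, -, hg⟩ := h.exists_sub_mem (hC.monomial_mem (h.mul_mem hTB) hu)
  have hdvd := killVars_eq_zero_iff.2 (hF.prop hg)
  rw [map_sub, killVars_monomial huF, map_mul, sub_eq_zero] at hdvd
  obtain ⟨m, c, hmu, hc, hfm⟩ := dvd_monomial_one_iff_exists.1 (Dvd.intro _ hdvd.symm)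
  have hmF : ∀ i ∈ F, m i = 0 := fun i hi => Nat.le_zero.1 ((hmu i).trans (huF i hi).le)
  have hsub : f - monomial m c ∈ variableIdeal k F := by
    rw [← hfm]
    exact sub_killVars_mem F f
  have hcoeff : coeff m f = c := by
    by_contra hne
    obtain ⟨i, hi, hmi⟩ := mem_variableIdeal.1 hsub m (by
      rwa [coeff_sub, coeff_monomial, if_pos rfl, sub_ne_zero])
    exact hmi (hmF i hi)
  exact ⟨m, hmF, hcoeff ▸ hc.ne_zero, hcoeff ▸ hsub⟩

/-- Every minimal cover other than `F` meets the complement of `F`. So if `f` were in `P_F`,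
multiplying by the product of the variables outside `F` would put it in `A`, contradicting `A : f =
A`. -/
theorem notMem_variableIdeal (h : IsBasicDoubleGLink C f B A)
    (hA : IsSquarefreeMonomialIdeal A)
    {F : Finset (Fin n)} (hF : IsMinimalCover A F) : f ∉ variableIdeal k F := by
  classical
  intro hf
  have key : f * squarefreeMonomial k Fᶜ ∈ A := by
    refine hA.mem_of_forall_variableIdeal fun G hG => ?_
    by_cases hGF : G ⊆ F
    · rw [hGF.antisymm (hF.le_of_le hG.prop hGF)]
      exact Ideal.mul_mem_right _ _ hf
    · obtain ⟨i, hi, hiF⟩ := Finset.not_subset.1 hGF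
      exact Ideal.mul_mem_left _ _
        (squarefreeMonomial_mem_variableIdeal.2 ⟨i, by simpa using hiF, hi⟩)
  have hmem : squarefreeMonomial k Fᶜ ∈ A := by
    rw [← h.colon_eq]
    simpa [Submodule.mem_colon_singleton, mul_comm] using key
  obtain ⟨i, hi, hiF⟩ := squarefreeMonomial_mem_variableIdeal.1 (hF.prop hmem)
  exact (Finset.mem_compl.1 hi) hiF

/-- Modulo all minimal primes of `A`, the form `f` is a multiple of one and the same monomial. -/
theorem exists_monomial (h : IsBasicDoubleGLink C f B A)
    (hA : IsSquarefreeMonomialIdeal A) (hB : IsSquarefreeMonomialIdeal B)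
    (hC : IsSquarefreeMonomialIdeal C) :
    ∃ m, coeff m f ≠ 0 ∧ ∀ F, IsMinimalCover A F →
      (∀ i ∈ F, m i = 0) ∧ f - monomial m (coeff m f) ∈ variableIdeal k F := by
  classical
  have hex := fun F (hF : IsMinimalCover A F) =>
    h.exists_sub_monomial_mem hA hB hC (fun _ => h.notMem_variableIdeal hA) hF
  obtain ⟨F₀, hF₀⟩ := hA.exists_minimalCover h.properA
  obtain ⟨m, -, hm, hm₀⟩ := hex F₀ hF₀
  refine ⟨m, hm, fun G₀ hG₀ => ?_⟩
  suffices hall : f - monomial m (coeff m f) ∈ variableIdeal k G₀ by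
    refine ⟨fun i hi => ?_, hall⟩
    by_contra hmi
    refine h.notMem_variableIdeal hA hG₀ ?_
    rw [← sub_add_cancel f (monomial m (coeff m f))]
    exact add_mem hall ((monomial_mem_variableIdeal hm).2 ⟨i, hi, hmi⟩)
  by_contra hcG₀
  obtain ⟨F, G, hF, hG, hcF, hcG, hcard⟩ := exists_adjacent_minimalCovers hA h.cohenMacaulay
    (fun _ _ hF hG => hF.card_eq hA h.unmixedA hG)
    (fun F => f - monomial m (coeff m f) ∈ variableIdeal k F) ⟨F₀, hF₀, hm₀⟩ ⟨G₀, hG₀, hcG₀⟩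
  have hFV : F ⊆ F ∪ G := Finset.subset_union_left
  have hGV : G ⊆ F ∪ G := Finset.subset_union_right
  -- the monomial vanishes modulo the second prime
  obtain ⟨m', hm'G, -, hm'⟩ := hex G hG
  have hmm' : m' ≠ m := fun h => hcG (h ▸ hm')
  obtain ⟨i, hiG, hmi⟩ := mem_variableIdeal.1 hm' m (by
    rwa [coeff_sub, coeff_monomial, if_neg hmm', sub_zero])
  have hmG : monomial m (1 : k) ∈ variableIdeal k G :=
    (monomial_mem_variableIdeal one_ne_zero).2 ⟨i, hiG, hmi⟩
  have hiF : i ∉ F := by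
    intro hiF
    refine h.notMem_variableIdeal hA hF ?_
    rw [← sub_add_cancel f (monomial m (coeff m f))]
    exact add_mem hcF ((monomial_mem_variableIdeal hm).2 ⟨i, hiF, hmi⟩)
  have hV : F ∪ G = insert i F := by
    symm
    refine Finset.eq_of_subset_of_card_le
      (Finset.insert_subset (hGV hiG) hFV) ?_
    rwa [Finset.card_insert_of_notMem hiF]
  have hmF : monomial m (1 : k) ∉ variableIdeal k F := by
    intro hmem
    refine h.notMem_variableIdeal hA hF ?_
    rw [← sub_add_cancel f (monomial m (coeff m f))]
    exact add_mem hcF ((monomial_mem_variableIdeal hm).2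
      ((monomial_mem_variableIdeal one_ne_zero).1 hmem))
  -- Modulo `P_F`, `f` is a scalar times `x^m`, so `x^m` can be cancelled there.
  have hdiv : ∀ p, monomial m 1 * p ∈ C →
      ∃ g ∈ B, p - MvPolynomial.C (coeff m f) * g ∈ variableIdeal k F ∧ monomial m 1 * p - f * g ∈ A := by
    intro p hp
    obtain ⟨g, hgB, hg⟩ := h.exists_sub_mem hp
    refine ⟨g, hgB, ?_, hg⟩
    refine ((isPrime_variableIdeal F).mem_or_mem (x := monomial m 1) ?_).resolve_left hmF
    have := add_mem (hF.prop hg) (Ideal.mul_mem_right g _ hcF)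
    convert this using 1
    rw [show monomial m (coeff m f) = monomial m 1 * MvPolynomial.C (coeff m f) by
      rw [mul_comm, C_mul_monomial, mul_one]]
    ring
  have hfC : ∀ T, squarefreeMonomial k T ∈ B →
      monomial m 1 * squarefreeMonomial k T ∈ C := by
    intro T hT
    rw [squarefreeMonomial_eq] at hT ⊢
    rw [monomial_mul, one_mul]
    refine hC.monomial_mem (h.mul_mem hT) ?_
    rwa [coeff_mul_monomial, mul_one]
  -- Modulo `P_G` the monomial `x^m` dies but `f` does not, so the cofactor `g` lies in `P_G`.
  have hBV : B ≤ variableIdeal k (F ∪ G) := hB.le_of_forall_squarefreeMonomial fun T hT => by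
    obtain ⟨g, -, hgF, hg⟩ := hdiv _ (hfC T hT)
    have hgG : g ∈ variableIdeal k G := by
      refine ((isPrime_variableIdeal G).mem_or_mem (x := f) ?_).resolve_left
        (h.notMem_variableIdeal hA hG)
      have := sub_mem (Ideal.mul_mem_right (squarefreeMonomial k T) _ hmG) (hG.prop hg)
      rwa [sub_sub_cancel] at this
    have := add_mem (variableIdeal_mono hFV hgF)
      (Ideal.mul_mem_left _ (MvPolynomial.C (coeff m f)) (variableIdeal_mono hGV hgG))
    rwa [sub_add_cancel] at this
  obtain ⟨T, hTB, hTF⟩ := hB.exists_squarefreeMonomial_notMem (h.not_le_variableIdeal hA hF)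
  have hTF' : ∀ j ∈ T, j ∉ F := fun j hj hjF =>
    hTF (squarefreeMonomial_mem_variableIdeal.2 ⟨j, hj, hjF⟩)
  -- Since `x_i` divides `x^m` and `C` is squarefree, erasing `i` from `T` does not leave `C`. The
  -- erased monomial then falls into `P_V`, although `T.erase i` misses `V = insert i F`.
  have hmT : monomial m 1 * squarefreeMonomial k (T.erase i) ∈ C := by
    have := hfC T hTB
    rw [squarefreeMonomial_eq, monomial_mul, one_mul] at this ⊢
    refine hC.monomial_mem_of_support_subset this fun j hj => ?_
    simp only [Finsupp.add_apply, finsetExponent_apply, Finset.mem_erase] at hj ⊢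
    by_cases hji : j = i
    · subst hji
      omega
    · simpa [hji] using hj
  obtain ⟨g, hgB, hgF, -⟩ := hdiv _ hmT
  have hTV : squarefreeMonomial k (T.erase i) ∈ variableIdeal k (F ∪ G) := by
    have := add_mem (variableIdeal_mono hFV hgF) (Ideal.mul_mem_left _ (MvPolynomial.C (coeff m f)) (hBV hgB))
    rwa [sub_add_cancel] at this
  rw [hV] at hTV
  obtain ⟨j, hjT, hj⟩ := squarefreeMonomial_mem_variableIdeal.1 hTV
  rw [Finset.mem_erase] at hjT
  exact hTF' j hjT.2 ((Finset.mem_insert.1 hj).resolve_left hjT.1)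

/-- In a squarefree basic double G-link, `A` is generated by the generators of `C` that avoid
a suitable variable. -/
theorem exists_eq_span {s : Set (Finset (Fin n))}
    (h : IsBasicDoubleGLink (Ideal.span (squarefreeMonomial k '' s)) f B A)
    (hA : IsSquarefreeMonomialIdeal A) (hB : IsSquarefreeMonomialIdeal B) :
    ∃ i, A = Ideal.span (squarefreeMonomial k '' {T ∈ s | i ∉ T}) := by
  classical
  obtain ⟨m, hm, hmF⟩ := h.exists_monomial hA hB ⟨s, rfl⟩
  obtain ⟨d, hd, hfd⟩ := h.homogeneous
  obtain ⟨i, hi⟩ : ∃ i, m i ≠ 0 := by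
    by_contra! h0
    have := hfd hm
    rw [show m = 0 from Finsupp.ext h0, map_zero] at this
    omega
  have hiF : ∀ F, IsMinimalCover A F → i ∉ F := fun F hF hiF => hi ((hmF F hF).1 i hiF)
  refine ⟨i, le_antisymm (hA.le_of_forall_squarefreeMonomial fun T hT => ?_) ?_⟩
  -- No minimal cover of `A` uses `i`, so `x_i` can be dropped from monomials of `A`.
  · have hTi : squarefreeMonomial k (T.erase i) ∈ A := hA.mem_of_forall_variableIdeal fun F hF => by
      obtain ⟨j, hj, hjF⟩ := squarefreeMonomial_mem_variableIdeal.1 (hF.prop hT)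
      exact squarefreeMonomial_mem_variableIdeal.2
        ⟨j, Finset.mem_erase.2 ⟨fun hji => hiF F hF (hji ▸ hjF), hj⟩, hjF⟩
    have hTi' := h.le_self hTi
    rw [squarefreeMonomial_eq, mem_span_squarefreeMonomial] at hTi'
    obtain ⟨U, hU, hUT⟩ := hTi' (finsetExponent (T.erase i)) (by simp)
    have hUT' : U ⊆ T.erase i := fun j hj => by
      have := hUT j hj
      rw [finsetExponent_apply] at this
      by_contra hj'
      exact this (if_neg hj')
    rw [mem_span_squarefreeMonomial]
    intro u hu
    rw [squarefreeMonomial_eq, coeff_monomial] at hu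
    split_ifs at hu with huT
    · refine ⟨U, ⟨hU, fun hiU => (Finset.mem_erase.1 (hUT' hiU)).1 rfl⟩, fun j hj => ?_⟩
      rw [← huT, finsetExponent_apply, if_pos (Finset.mem_of_mem_erase (hUT' hj))]
      exact one_ne_zero
    · exact absurd rfl hu
  · rw [Ideal.span_le]
    rintro _ ⟨T, ⟨hT, hiT⟩, rfl⟩
    refine hA.mem_of_forall_variableIdeal fun F hF => ?_
    obtain ⟨g, -, hg⟩ := h.exists_sub_mem (Ideal.subset_span ⟨T, hT, rfl⟩)
    have hmem : squarefreeMonomial k T - monomial m (coeff m f) * g ∈ variableIdeal k F := by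
      have := add_mem (hF.prop hg) (Ideal.mul_mem_right g _ (hmF F hF).2)
      convert this using 1
      ring
    -- As `x^m` does not divide `x_T`, subtracting a multiple of `x^m` leaves the coefficient of
    -- `x_T` equal to `1`.
    have hle : ¬ m ≤ finsetExponent T := fun hle => hi (by
      have := hle i
      rwa [finsetExponent_apply, if_neg hiT, Nat.le_zero] at this)
    obtain ⟨j, hj, hTj⟩ := mem_variableIdeal.1 hmem (finsetExponent T) (by
      rw [coeff_sub, squarefreeMonomial_eq, coeff_monomial, if_pos rfl, coeff_monomial_mul',
        if_neg hle, sub_zero]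
      exact one_ne_zero)
    rw [finsetExponent_apply] at hTj
    exact squarefreeMonomial_mem_variableIdeal.2 ⟨j, by simpa using hTj, hj⟩

end IsBasicDoubleGLink

end BasicDoubleGLink

/-! ### From Koszul cocycles to simplicial cocycles -/

section Coboundary

variable {k : Type*} [Field k] {n : ℕ} {A : Ideal (MvPolynomial (Fin n) k)}

/-- A simplicial `1`-cocycle on the complex of a Cohen-Macaulay Stanley-Reisner ring of dimension
at least three is a coboundary. -/
theorem exists_coboundary_of_isCohenMacaulayRing
    (hCM : IsCohenMacaulayRing (MvPolynomial (Fin n) k ⧸ A)) {F V : Finset (Fin n)}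
    (hF : A ≤ variableIdeal k F) (hFV : F ⊆ V) (hcard : F.card + 3 ≤ V.card)
    (ρ : Fin n → Fin n → ℤ)
    (hρ : ∀ i ∈ V, ∀ j ∈ V, ∀ l ∈ V, ρ j l - ρ i l + ρ i j = 0 ∨ X i * X j * X l ∈ A) :
    ∃ τ : k, τ ≠ 0 ∧ ∃ σ : Fin n → k, ∀ i ∈ V, ∀ j ∈ V, ∀ G ⊆ V, A ≤ variableIdeal k G →
      i ∉ G → j ∉ G → τ * ρ i j = σ j - σ i := by
  classical
  -- The simplicial cochain becomes the Koszul cochain `ρ i j * x_i * x_j`; the cocycle identity may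
  -- fail only on triples whose product lies in `A`.
  obtain ⟨t, ht, s, hs⟩ := exists_mul_sub_sub_mem_of_koszul_cocycle hCM hF hFV hcard
    (fun i j => C (ρ i j : k) * (X i * X j)) (by
      intro i hi j hj l hl
      have heq : X i * (C (ρ j l : k) * (X j * X l)) - X j * (C (ρ i l : k) * (X i * X l)) +
          X l * (C (ρ i j : k) * (X i * X j)) =
          C ((ρ j l - ρ i l + ρ i j : ℤ) : k) * (X i * X j * X l) := by
        simp only [Int.cast_add, Int.cast_sub, map_add, map_sub]
        ring
      rw [heq]
      obtain h | h := hρ i hi j hj l hl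
      · simp [h]
      · exact Ideal.mul_mem_left _ _ h)
  rw [mem_variableIdeal] at ht
  push Not at ht
  obtain ⟨e, he, heV⟩ := ht
  -- Here `x^e` is a term of `t` free of variables of `V`; comparing coefficients of `x^e x_i x_j`
  -- recovers the simplicial identity.
  refine ⟨coeff e t, he, fun j => coeff (e + Finsupp.single j 1) (s j), ?_⟩
  intro i hi j hj G hGV hG hiG hjG
  have hmem := hs i hi j hj G hGV hG
  rw [mem_variableIdeal] at hmem
  have hzero := not_imp_comm.1 (hmem (e + Finsupp.single i 1 + Finsupp.single j 1)) (by
    rintro ⟨l, hl, hne⟩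
    have h1 : l ≠ i := fun h => hiG (h ▸ hl)
    have h2 : l ≠ j := fun h => hjG (h ▸ hl)
    simp [h1.symm, h2.symm, heV l (hGV hl)] at hne)
  rw [coeff_sub, coeff_sub] at hzero
  have h1 : coeff (e + Finsupp.single i 1 + Finsupp.single j 1)
      (t * (C (ρ i j : k) * (X i * X j))) = coeff e t * ρ i j := by
    rw [show t * (C (ρ i j : k) * (X i * X j)) = C (ρ i j : k) * (t * X i * X j) by ring,
      coeff_C_mul, coeff_mul_X, coeff_mul_X, mul_comm]
  have h2 : coeff (e + Finsupp.single i 1 + Finsupp.single j 1) (X i * s j) =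
      coeff (e + Finsupp.single j 1) (s j) := by
    rw [add_right_comm, mul_comm, coeff_mul_X]
  have h3 : coeff (e + Finsupp.single i 1 + Finsupp.single j 1) (X j * s i) =
      coeff (e + Finsupp.single i 1) (s i) := by
    rw [mul_comm, coeff_mul_X]
  rw [h1, h2, h3, sub_eq_zero] at hzero
  exact hzero

end Coboundary

/-! ### Obstructions for ideals generated by the monomials avoiding a variable -/

section Deletion

variable {k : Type*} [Field k] {n : ℕ}

theorem X_mul_X_mul_X_mem_span {s : Set (Finset (Fin n))} {i j l : Fin n}
    (h : ∃ T ∈ s, T ⊆ {i, j, l}) :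
    (X i * X j * X l : MvPolynomial (Fin n) k) ∈ Ideal.span (squarefreeMonomial k '' s) := by
  obtain ⟨T, hT, hTs⟩ := h
  have heq : (X i * X j * X l : MvPolynomial (Fin n) k) =
      monomial (Finsupp.single i 1 + Finsupp.single j 1 + Finsupp.single l 1) 1 := by
    rw [X, X, X, monomial_mul, monomial_mul, one_mul, one_mul]
  rw [heq]
  refine IsSquarefreeMonomialIdeal.monomial_mem_of_support_subset ⟨s, rfl⟩
    (u := finsetExponent T) ?_ (fun a ha => ?_)
  · rw [← squarefreeMonomial_eq]
    exact Ideal.subset_span ⟨T, hT, rfl⟩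
  · have haT : a ∈ T := by
      by_contra h
      exact ha (by rw [finsetExponent_apply, if_neg h])
    have := hTs haT
    simp only [Finset.mem_insert, Finset.mem_singleton] at this
    simp only [Finsupp.add_apply, Finsupp.single_apply]
    obtain rfl | rfl | rfl := this <;> simp

/-- `F` meets all members of `s` that avoid `i`, and no proper subset of `F` does. -/
def IsMinimalTransversalAvoiding (s : Finset (Finset (Fin n))) (i : Fin n)
    (F : Finset (Fin n)) : Prop :=
  (∀ T ∈ s, i ∉ T → ∃ j ∈ T, j ∈ F) ∧ ∀ j ∈ F, ∃ T ∈ s, i ∉ T ∧ ∀ l ∈ T, l ∈ F → l = j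

instance (s : Finset (Finset (Fin n))) (i : Fin n) (F : Finset (Fin n)) :
    Decidable (IsMinimalTransversalAvoiding s i F) :=
  inferInstanceAs (Decidable (_ ∧ _))

theorem span_deletion_le_variableIdeal {s : Finset (Finset (Fin n))} {i : Fin n}
    {F : Finset (Fin n)} (h : ∀ T ∈ s, i ∉ T → ∃ j ∈ T, j ∈ F) :
    Ideal.span (squarefreeMonomial k '' {T ∈ (s : Set (Finset (Fin n))) | i ∉ T}) ≤
      variableIdeal k F :=
  span_le_variableIdeal_iff.2 fun T hT => h T hT.1 hT.2

theorem IsMinimalTransversalAvoiding.isMinimalCover {s : Finset (Finset (Fin n))} {i : Fin n}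
    {F : Finset (Fin n)} (h : IsMinimalTransversalAvoiding s i F) :
    IsMinimalCover
      (Ideal.span (squarefreeMonomial k '' {T ∈ (s : Set (Finset (Fin n))) | i ∉ T})) F := by
  refine ⟨span_deletion_le_variableIdeal h.1, fun G hG hGF j hj => ?_⟩
  obtain ⟨T, hT, hiT, hTj⟩ := h.2 j hj
  obtain ⟨l, hl, hlG⟩ := span_le_variableIdeal_iff.1 hG T ⟨hT, hiT⟩
  exact hTj l hl (hGF hlG) ▸ hlG

theorem not_isHeightUnmixed_deletion {s : Finset (Finset (Fin n))} {i : Fin n}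
    {F G : Finset (Fin n)} (hF : IsMinimalTransversalAvoiding s i F)
    (hG : IsMinimalTransversalAvoiding s i G) (hcard : F.card ≠ G.card) :
    ¬ IsHeightUnmixed
      (Ideal.span (squarefreeMonomial k '' {T ∈ (s : Set (Finset (Fin n))) | i ∉ T})) :=
  fun h => hcard (hF.isMinimalCover.card_eq ⟨_, rfl⟩ h hG.isMinimalCover)

/-- A simplicial `1`-cocycle with nonzero sum along a closed walk of five edges obstructs
Cohen-Macaulayness. -/
theorem not_isCohenMacaulayRing_deletion [CharZero k] {s : Finset (Finset (Fin n))} {i : Fin n}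
    {F V : Finset (Fin n)} (hF : ∀ T ∈ s, i ∉ T → ∃ j ∈ T, j ∈ F) (hFV : F ⊆ V)
    (hcard : F.card + 3 ≤ V.card) (ρ : Fin n → Fin n → ℤ)
    (hρ : ∀ a ∈ V, ∀ b ∈ V, ∀ c ∈ V, ρ b c - ρ a c + ρ a b = 0 ∨
      ∃ T ∈ s, i ∉ T ∧ T ⊆ {a, b, c})
    (w : Fin 5 → Fin n) (G : Fin 5 → Finset (Fin n))
    (hw : ∀ a, w a ∈ V ∧ G a ⊆ V ∧ (∀ T ∈ s, i ∉ T → ∃ j ∈ T, j ∈ G a) ∧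
      w a ∉ G a ∧ w (a + 1) ∉ G a)
    (hsum : ∑ a, ρ (w a) (w (a + 1)) ≠ 0) :
    ¬ IsCohenMacaulayRing (MvPolynomial (Fin n) k ⧸
      Ideal.span (squarefreeMonomial k '' {T ∈ (s : Set (Finset (Fin n))) | i ∉ T})) := by
  intro hCM
  obtain ⟨τ, hτ, σ, hσ⟩ := exists_coboundary_of_isCohenMacaulayRing hCM
    (span_deletion_le_variableIdeal hF) hFV hcard ρ fun a ha b hb c hc =>
      (hρ a ha b hb c hc).imp_right fun ⟨T, hT, hiT, hTs⟩ =>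
        X_mul_X_mul_X_mem_span ⟨T, ⟨hT, hiT⟩, hTs⟩
  have hstep : ∀ a, τ * ρ (w a) (w (a + 1)) = σ (w (a + 1)) - σ (w a) := fun a => by
    obtain ⟨ha, hGV, hG, h1, h2⟩ := hw a
    exact hσ _ ha _ (hw (a + 1)).1 (G a) hGV (span_deletion_le_variableIdeal hG) h1 h2
  have hzero : τ * ((∑ a, ρ (w a) (w (a + 1)) : ℤ) : k) = 0 := by
    rw [Int.cast_sum, Finset.mul_sum, Finset.sum_congr rfl fun a _ => hstep a,
      Finset.sum_sub_distrib, sub_eq_zero]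
    -- Addition in `Fin 5` wraps around, so the differences telescope over the closed walk.
    exact Equiv.sum_comp (Equiv.addRight (1 : Fin 5)) fun a => σ (w a)
  exact (mul_ne_zero hτ (Int.cast_ne_zero.2 hsum)) hzero

end Deletion

/-! ### The two ideals of the example -/

/-- The antisymmetric function on pairs taking the value `1` on the pairs in `s`. -/
def pairCochain (s : Finset (Fin 6 × Fin 6)) (i j : Fin 6) : ℤ :=
  (if (i, j) ∈ s then 1 else 0) - if (j, i) ∈ s then 1 else 0

/-- The minimal nonfaces of `exampleComplex`. -/
def exampleNonfaces : Finset (Finset (Fin 6)) :=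
  {{0, 1, 2}, {0, 1, 3}, {0, 1, 4}, {0, 2, 3}, {0, 2, 5},
    {1, 3, 4}, {1, 4, 5}, {2, 3, 5}, {2, 4, 5}, {3, 4, 5}}

theorem stanleyReisnerIdeal_exampleComplex :
    stanleyReisnerIdeal ℚ exampleComplex =
      Ideal.span (squarefreeMonomial ℚ '' (exampleNonfaces : Set (Finset (Fin 6)))) := by
  have hdec : ∀ F : Finset (Fin 6),
      (∃ T ∈ exampleTriples, F ⊆ T) ∨ ∃ N ∈ exampleNonfaces, N ⊆ F := by
    decide +kernel
  have hnon : ∀ N ∈ exampleNonfaces, ∀ T ∈ exampleTriples, ¬ N ⊆ T := by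
    decide +kernel
  refine le_antisymm (Ideal.span_le.2 ?_) (Ideal.span_mono (Set.image_mono ?_))
  · rintro _ ⟨F, hF, rfl⟩
    obtain ⟨T, hT, hFT⟩ | ⟨N, hN, hNF⟩ := hdec F
    · exact absurd ⟨T, hT, hFT⟩ hF
    · have hdvd : squarefreeMonomial ℚ N ∣ squarefreeMonomial ℚ F :=
        Finset.prod_dvd_prod_of_subset _ _ _ hNF
      exact Ideal.mem_of_dvd _ hdvd (Ideal.subset_span ⟨N, hN, rfl⟩)
  · rintro N hN ⟨T, hT, hNT⟩
    exact hnon N hN T hT hNT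

theorem not_isBasicDoubleGLink_exampleIdeal {A B : Ideal (MvPolynomial (Fin 6) ℚ)}
    {f : MvPolynomial (Fin 6) ℚ} (hA : IsSquarefreeMonomialIdeal A)
    (hB : IsSquarefreeMonomialIdeal B) : ¬ IsBasicDoubleGLink exampleIdeal f B A := by
  intro h
  obtain ⟨i, rfl⟩ := IsBasicDoubleGLink.exists_eq_span h hA hB
  have hU := h.unmixedA
  have hCM := h.cohenMacaulay
  fin_cases i
  · exact not_isHeightUnmixed_deletion (F := {1, 2}) (G := {3, 4, 5})
      (by decide +kernel) (by decide +kernel) (by decide) hU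
  · exact not_isHeightUnmixed_deletion (F := {0, 2}) (G := {2, 3, 5})
      (by decide +kernel) (by decide +kernel) (by decide) hU
  · exact not_isHeightUnmixed_deletion (F := {0, 1}) (G := {1, 3, 4})
      (by decide +kernel) (by decide +kernel) (by decide) hU
  -- Möbius strip with triangles `012, 014, 145, 245, 025`. The cochain counts crossings of an arc
  -- cutting the strip through the edges `12, 01, 04`; the walk is the core circle, and each `G a`
  -- is the complement in `V` of a triangle containing the edge walked.
  · exact not_isCohenMacaulayRing_deletion (F := {0, 1}) (V := {0, 1, 2, 4, 5})
      (by decide +kernel) (by decide) (by decide) (pairCochain {(0, 1), (0, 4), (2, 1)})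
      (by decide +kernel) ![0, 1, 4, 5, 2]
      ![{2, 5}, {2, 5}, {0, 1}, {0, 1}, {1, 4}] (by decide +kernel) (by decide +kernel) hCM
  · exact not_isHeightUnmixed_deletion (F := {0, 1}) (G := {0, 2, 3})
      (by decide +kernel) (by decide +kernel) (by decide) hU
  · exact not_isHeightUnmixed_deletion (F := {0, 2}) (G := {0, 1, 3})
      (by decide +kernel) (by decide +kernel) (by decide) hU

theorem not_isBasicDoubleGLink_stanleyReisnerIdeal {A B : Ideal (MvPolynomial (Fin 6) ℚ)}
    {f : MvPolynomial (Fin 6) ℚ} (hA : IsSquarefreeMonomialIdeal A)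
    (hB : IsSquarefreeMonomialIdeal B) :
    ¬ IsBasicDoubleGLink (stanleyReisnerIdeal ℚ exampleComplex) f B A := by
  intro h
  rw [stanleyReisnerIdeal_exampleComplex] at h
  obtain ⟨i, rfl⟩ := IsBasicDoubleGLink.exists_eq_span h hA hB
  have hU := h.unmixedA
  have hCM := h.cohenMacaulay
  fin_cases i
  · exact not_isHeightUnmixed_deletion (F := {1, 5}) (G := {1, 2, 3})
      (by decide +kernel) (by decide +kernel) (by decide) hU
  · exact not_isHeightUnmixed_deletion (F := {0, 5}) (G := {0, 3, 4})
      (by decide +kernel) (by decide +kernel) (by decide) hU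
  · exact not_isHeightUnmixed_deletion (F := {0, 4}) (G := {0, 3, 5})
      (by decide +kernel) (by decide +kernel) (by decide) hU
  -- Here the triangles are the other five triples in `V`: `045, 024, 124, 125, 015`, again a Möbius
  -- strip. The arc crosses `45, 05, 01`, and the walk is the core circle.
  · exact not_isCohenMacaulayRing_deletion (F := {0, 4}) (V := {0, 1, 2, 4, 5})
      (by decide +kernel) (by decide) (by decide) (pairCochain {(0, 5), (0, 1), (4, 5)})
      (by decide +kernel) ![1, 2, 4, 0, 5]
      ![{0, 4}, {0, 5}, {1, 2}, {1, 2}, {0, 4}] (by decide +kernel) (by decide +kernel) hCM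
  · exact not_isHeightUnmixed_deletion (F := {0, 2}) (G := {1, 3, 5})
      (by decide +kernel) (by decide +kernel) (by decide) hU
  · exact not_isHeightUnmixed_deletion (F := {0, 1}) (G := {2, 3, 4})
      (by decide +kernel) (by decide +kernel) (by decide) hU

theorem proposition4p5 :
    (¬ ∃ (A B : Ideal (MvPolynomial (Fin 6) ℚ)) (f : MvPolynomial (Fin 6) ℚ),
      IsSquarefreeMonomialIdeal A ∧ IsSquarefreeMonomialIdeal B ∧ IsSumOfMonicMonomials f ∧
        IsBasicDoubleGLink exampleIdeal f B A) ∧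
    (¬ ∃ (A B : Ideal (MvPolynomial (Fin 6) ℚ)) (f : MvPolynomial (Fin 6) ℚ),
      IsSquarefreeMonomialIdeal A ∧ IsSquarefreeMonomialIdeal B ∧ IsSumOfMonicMonomials f ∧
        IsBasicDoubleGLink (stanleyReisnerIdeal ℚ exampleComplex) f B A) := by
  constructor
  · rintro ⟨A, B, f, hA, hB, -, h⟩
    exact not_isBasicDoubleGLink_exampleIdeal hA hB h
  · rintro ⟨A, B, f, hA, hB, -, h⟩
    exact not_isBasicDoubleGLink_stanleyReisnerIdeal hA hB h
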